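/- A digraph $G$ is a finite vertex set $V(G)$ together with a set $A(G)\subseteq\{(u,v)\in V(G)^2 : u\neq v\}$ of arcs (so there are no loops and no parallel arcs, but $(u,v)$ and $(v,u)$ may both be arcs). A subdigraph of $G$ is a digraph $H$ with $V(H)\subseteq V(G)$ and $A(H)\subseteq A(G)$; it is proper if $H\neq G$. The dichromatic number $\vec\chi(G)$ is the least $n\in\mathbb{N}$ such that $V(G)$ can be coloured with $n$ colours so that every colour class induces a subdigraph without directed cycles (a pair of opposite arcs being a directed cycle of length $2$). The digraph $G$ is $k$-dicritical if $\vec\chi(G)=k$ and $\vec\chi(H)<k$ for every proper subdigraph $H$ of $G$. Let $\overset{\leftrightarrow}{K}_k$ be the digraph on $k$ vertices with all $k(k-1)$ possible arcs. For a vertex $u$ let $d(u)$ be the sum of its in-degree and its out-degree, and let $\varepsilon_k(G)=\sum_{u\in V(G)}\bigl(d(u)-2(k-1)\bigr)$ be the excess of $G$. **Theorem.** Let $k\ge 4$ be an integer and let $G$ be a $k$-dicritical digraph that is not isomorphic to $\overset{\leftrightarrow}{K}_k$. Then $$|A(G)|\ \ge\ (k-1)\,|V(G)|+k-3 .$$ In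 other words, $\varepsilon_k(G)\ge 2(k-3)$. -/

import Mathlib

namespace Digraph

variable {V : Type*}

/-- The subdigraph `G[X]` induced by a set `X` of vertices. -/
def inducedOn (G : Digraph V) (X : Set V) : Digraph X where
  Adj u v := G.Adj u v

/-- A digraph is acyclic when it has no (directed) cycle, that is, no walk of positive length
from a vertex to itself. -/
def IsAcyclicDigraph (G : Digraph V) : Prop :=
  ∀ v : V, ¬ Relation.TransGen G.Adj v v

/-- A dicolouring: every colour class induces an acyclic digraph. -/
def IsDicolouring {α : Type*} (G : Digraph V) (φ : V → α) : Prop :=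
  ∀ c : α, (G.inducedOn (φ ⁻¹' {c})).IsAcyclicDigraph

/-- `G` has a dicolouring with at most `n` colours. -/
def Dicolourable (G : Digraph V) (n : ℕ) : Prop :=
  ∃ φ : V → Fin n, G.IsDicolouring φ

/-- The dichromatic number: the least `n` such that `G` is `n`-dicolourable
(`⊤` if there is no such `n`, which does not happen for finite loopless digraphs). -/
noncomputable def dichromaticNumber (G : Digraph V) : ℕ∞ :=
  ⨅ n ∈ {n : ℕ | G.Dicolourable n}, (n : ℕ∞)

/-- A subdigraph of `G`: a set of vertices of `G` and a set of arcs of `G` between them. -/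
structure Subdigraph (G : Digraph V) where
  verts : Set V
  Adj : V → V → Prop
  adj_sub : ∀ {u v : V}, Adj u v → G.Adj u v
  fst_mem : ∀ {u v : V}, Adj u v → u ∈ verts
  snd_mem : ∀ {u v : V}, Adj u v → v ∈ verts

/-- A subdigraph seen as a digraph on its own vertex set. -/
def Subdigraph.toDigraph {G : Digraph V} (H : G.Subdigraph) : Digraph H.verts where
  Adj u v := H.Adj u v

/-- A subdigraph of `G` is proper when it differs from `G` in its vertices or in its arcs. -/
def Subdigraph.IsProper {G : Digraph V} (H : G.Subdigraph) : Prop :=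
  H.verts ≠ Set.univ ∨ H.Adj ≠ G.Adj

/-- Every proper subdigraph has a smaller dichromatic number. -/
def IsDicritical (G : Digraph V) : Prop :=
  ∀ H : G.Subdigraph, H.IsProper → H.toDigraph.dichromaticNumber < G.dichromaticNumber

/-- `k`-dicritical: dicritical with dichromatic number `k`. -/
def IsKDicritical (G : Digraph V) (k : ℕ) : Prop :=
  G.IsDicritical ∧ G.dichromaticNumber = k

/-- The symmetric complete digraph on `n` vertices (without loops). -/
def symmComplete (n : ℕ) : Digraph (Fin n) where
  Adj i j := i ≠ j

/-- Two digraphs are isomorphic. -/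
def Isomorphic {W : Type*} (G : Digraph V) (H : Digraph W) : Prop :=
  Nonempty (G.Adj ≃r H.Adj)

/-- The set of arcs. -/
def arcSet (G : Digraph V) : Set (V × V) := {a | G.Adj a.1 a.2}

/-- The out-neighbourhood of a vertex. -/
def outNeighbours (G : Digraph V) (x : V) : Set V := {u | u ≠ x ∧ G.Adj x u}

/-- The in-neighbourhood of a vertex. -/
def inNeighbours (G : Digraph V) (x : V) : Set V := {u | u ≠ x ∧ G.Adj u x}

/-- The degree of a vertex: out-degree plus in-degree. -/
noncomputable def totalDegree (G : Digraph V) (x : V) : ℕ :=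
  (G.outNeighbours x).ncard + (G.inNeighbours x).ncard

/-- The excess `d(x) - 2(k-1)` of a vertex. -/
noncomputable def vertexExcess (G : Digraph V) (k : ℕ) (x : V) : ℤ :=
  (G.totalDegree x : ℤ) - 2 * ((k : ℤ) - 1)

/-- The excess of a finite digraph: the sum of the excesses of its vertices. -/
noncomputable def excess [Fintype V] (G : Digraph V) (k : ℕ) : ℤ :=
  ∑ x : V, G.vertexExcess k x

end Digraph

section

open Relation Finset
open scoped Classical

namespace Dicritical

variable {V : Type*}

/-! Put `m = k - 1`. In a critical set every out-degree is at least `m`, so `pot ≤ 0`; the goal is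
`pot ≤ 2 - m` unless the set is complete on `m + 1` vertices, and the excess is `-2 * pot`.

The engine is the gap lemma `Crit.pot_add_le`. Contract the colour classes of a dicolouring of a
proper subset `R`. The result is still not `m`-dicolourable, and adjoining one of its critical
subsets to `R` lowers the potential by at least `m`.

In a smallest counterexample the excess is so small that most vertices are low, i.e. have out-degree
exactly `m`. Identify two out-neighbours `x`, `y` of a low vertex that are not joined both ways: the
gap lemma and minimality force a complete set on `m + 1` vertices, hence in `S` a complete set of
`m` vertices, each joined to and from `{x, y}` (`Crit.exists_complete_of_low`). By Hall's theorem
and the gap lemma, the low vertices of a complete `m`-set `Q` share one outside neighbour, its apex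
`x` (`Crit.exists_apex`). Some `q` in `Q` is not joined both ways to `x`. Identifying `x` with `q`
yields a second complete `m`-set `P`, disjoint from `Q`, whose apex is `x` or `q`; that vertex has a
degree too large for the available excess. -/

/-- The arcs of `r` inside `S` whose ends have the same colour. -/
def Mono {α : Type*} (r : V → V → Prop) (S : Finset V) (φ : V → α) (a b : V) : Prop :=
  a ∈ S ∧ b ∈ S ∧ r a b ∧ φ a = φ b

/-- `φ` is a dicolouring of the restriction of `r` to `S`. -/
def IsCol {α : Type*} (r : V → V → Prop) (S : Finset V) (φ : V → α) : Prop :=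
  ∀ v, ¬ TransGen (Mono r S φ) v v

/-- The restriction of `r` to `S` has a dicolouring with `m` colours. -/
def Col (r : V → V → Prop) (m : ℕ) (S : Finset V) : Prop :=
  ∃ φ : V → Fin m, IsCol r S φ

/-- `S` is vertex-critical for dicolourings of `r` with `m` colours. -/
def Crit (r : V → V → Prop) (m : ℕ) (S : Finset V) : Prop :=
  ¬ Col r m S ∧ ∀ v ∈ S, Col r m (S.erase v)

/-- The number of out-neighbours of `a` in `B`. -/
noncomputable def outDeg (r : V → V → Prop) (B : Finset V) (a : V) : ℕ := #{b ∈ B | r a b}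

/-- The number of arcs from `A` to `B`. -/
noncomputable def arcs (r : V → V → Prop) (A B : Finset V) : ℕ := ∑ a ∈ A, outDeg r B a

/-- The potential `m |S| - |A(S)|`. -/
noncomputable def pot (r : V → V → Prop) (m : ℕ) (S : Finset V) : ℤ :=
  (m : ℤ) * #S - arcs r S S

/-- The image of `r` under the identification `f`, without loops. -/
def collapse (f : V → V) (r : V → V → Prop) (a b : V) : Prop :=
  a ≠ b ∧ ∃ u v, r u v ∧ f u = a ∧ f v = b

/-! ### Dicolourings of vertex sets and critical sets -/

variable {r : V → V → Prop} {m : ℕ} {S T : Finset V}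

theorem transGen_imp {R R' : V → V → Prop} (h : ∀ a b, R a b → R' a b) {a b : V}
    (hab : TransGen R a b) : TransGen R' a b :=
  TransGen.mono h a b hab

theorem IsCol.mono {α : Type*} {r' : V → V → Prop} {φ : V → α} (h : IsCol r' T φ) (hST : S ⊆ T)
    (hr : ∀ a ∈ S, ∀ b ∈ S, r a b → r' a b) : IsCol r S φ := fun v hv =>
  h v (transGen_imp (fun a b ⟨ha, hb, hab, e⟩ => ⟨hST ha, hST hb, hr a ha b hb hab, e⟩) hv)

theorem Col.mono {r' : V → V → Prop} (h : Col r' m T) (hST : S ⊆ T)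
    (hr : ∀ a ∈ S, ∀ b ∈ S, r a b → r' a b) : Col r m S := by
  obtain ⟨φ, hφ⟩ := h
  exact ⟨φ, hφ.mono hST hr⟩

theorem Crit.col_of_ssubset (h : Crit r m S) (hT : T ⊆ S) (hne : T ≠ S) : Col r m T := by
  obtain ⟨v, hv, hvT⟩ := Finset.exists_of_ssubset (hT.ssubset_of_ne hne)
  refine (h.2 v hv).mono (fun a ha => ?_) fun _ _ _ _ h => h
  exact Finset.mem_erase.2 ⟨fun e => hvT (e ▸ ha), hT ha⟩

theorem exists_crit (h : ¬ Col r m S) : ∃ W ⊆ S, Crit r m W := by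
  induction S using Finset.strongInduction with
  | H S ih =>
    by_cases hc : ∀ v ∈ S, Col r m (S.erase v)
    · exact ⟨S, Subset.rfl, h, hc⟩
    · push Not at hc
      obtain ⟨v, hv, hv'⟩ := hc
      obtain ⟨W, hW, hW'⟩ := ih _ (Finset.erase_ssubset hv) hv'
      exact ⟨W, hW.trans (Finset.erase_subset _ _), hW'⟩

theorem isCol_swap {α : Type*} {φ : V → α} :
    IsCol (fun a b => r b a) S φ ↔ IsCol r S φ := by
  have key : ∀ {r : V → V → Prop}, IsCol r S φ → IsCol (fun a b => r b a) S φ := by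
    intro r h v hv
    apply h v
    have : TransGen (Function.swap (Mono r S φ)) v v :=
      transGen_imp (fun a b ⟨ha, hb, hab, e⟩ => ⟨hb, ha, hab, e.symm⟩) hv
    exact transGen_swap.1 this
  exact ⟨fun h => key h, key⟩

theorem Crit.swap (h : Crit r m S) : Crit (fun a b => r b a) m S := by
  refine ⟨fun ⟨φ, hφ⟩ => h.1 ⟨φ, isCol_swap.1 hφ⟩, fun v hv => ?_⟩
  obtain ⟨φ, hφ⟩ := h.2 v hv
  exact ⟨φ, isCol_swap.2 hφ⟩

/-- A walk cannot pass through a vertex of `Q`. The arcs into `a` and out of `b` exclude the two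
ends as well. -/
theorem transGen_avoid {R : V → V → Prop} {Q : Set V}
    (hQ : ∀ q ∈ Q, ∀ a b, R a q → R q b → False) {a b c d : V} (hca : R c a) (hbd : R b d)
    (h : TransGen R a b) : TransGen (fun x y => R x y ∧ x ∉ Q ∧ y ∉ Q) a b := by
  induction h generalizing d with
  | single h =>
    exact .single ⟨h, fun hq => hQ _ hq _ _ hca h, fun hq => hQ _ hq _ _ h hbd⟩
  | @tail y z hay hyz ih =>
    refine (ih hyz).tail ⟨hyz, fun hq => ?_, fun hq => hQ _ hq _ _ hyz hbd⟩
    obtain ⟨w, -, hw⟩ := TransGen.tail'_iff.1 hay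
    exact hQ _ hq _ _ hw hyz

/-- A dicolouring of `S \ Q` extends to `Q` if no vertex of `Q` has both an in-neighbour and an
out-neighbour of its own colour. -/
theorem isCol_extend {α : Type*} {Q : Finset V} {φ ψ : V → α} (hφ : IsCol r (S \ Q) φ)
    (hψ : ∀ a ∈ S, a ∉ Q → ψ a = φ a)
    (hQ : ∀ q ∈ Q, ∀ a ∈ S, ∀ b ∈ S, r a q → r q b → ψ a = ψ q → ψ b = ψ q → False) :
    IsCol r S ψ := by
  intro v hv
  obtain ⟨c, -, hc⟩ := TransGen.tail'_iff.1 hv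
  obtain ⟨d, hd, -⟩ := TransGen.head'_iff.1 hv
  have := transGen_avoid (Q := (Q : Set V)) (fun q hq a b ha hb =>
    hQ q hq a ha.1 b hb.2.1 ha.2.2.1 hb.2.2.1 ha.2.2.2 hb.2.2.2.symm) hc hd hv
  refine hφ v (transGen_imp ?_ this)
  rintro a b ⟨⟨ha, hb, hab, e⟩, haQ, hbQ⟩
  refine ⟨mem_sdiff.2 ⟨ha, haQ⟩, mem_sdiff.2 ⟨hb, hbQ⟩, hab, ?_⟩
  rw [← hψ a ha haQ, ← hψ b hb hbQ, e]

/-- Out-neighbours alone matter, since a monochromatic cycle through `v` has to leave `v`. -/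
theorem col_of_missing_colour (hr : ∀ v, ¬ r v v) {v : V} {φ : V → Fin m}
    (hφ : IsCol r (S.erase v) φ) {c : Fin m} (hc : ∀ b ∈ S, r v b → φ b ≠ c) : Col r m S := by
  refine ⟨Function.update φ v c, isCol_extend (Q := {v}) (φ := φ) ?_ ?_ ?_⟩
  · rwa [sdiff_singleton_eq_erase]
  · intro a _ ha
    exact Function.update_of_ne (by simpa using ha) _ _
  · intro q hq a _ b hb _ hqb _ e
    obtain rfl := mem_singleton.1 hq
    rw [Function.update_self, Function.update_of_ne (fun e => hr q (by rwa [e] at hqb))] at e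
    exact hc b hb hqb e

theorem Crit.le_outDeg (hr : ∀ v, ¬ r v v) (h : Crit r m S) {v : V} (hv : v ∈ S) :
    m ≤ outDeg r S v := by
  by_contra! hlt
  obtain ⟨φ, hφ⟩ := h.2 v hv
  obtain ⟨c, hc⟩ : ∃ c, c ∉ ({b ∈ S | r v b} : Finset V).image φ := by
    by_contra! hall
    have := Finset.card_le_card (fun c _ => hall c : univ ⊆ _)
    rw [Finset.card_univ, Fintype.card_fin] at this
    exact absurd (this.trans card_image_le) (not_le.2 hlt)
  refine h.1 (col_of_missing_colour hr hφ (c := c) fun b hb hvb e => hc ?_)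
  exact mem_image.2 ⟨b, by simp [hb, hvb], e⟩

theorem Crit.nonempty (h : Crit r m S) (hm : 0 < m) : S.Nonempty := by
  by_contra hS
  rw [not_nonempty_iff_eq_empty] at hS
  refine h.1 ⟨fun _ => ⟨0, hm⟩, fun v hv => ?_⟩
  obtain ⟨c, -, hc⟩ := TransGen.tail'_iff.1 hv
  simpa [hS] using hc.1

theorem outDeg_lt_card (hr : ∀ v, ¬ r v v) {v : V} (hv : v ∈ S) : outDeg r S v < #S :=
  Finset.card_lt_card (Finset.filter_ssubset.2 ⟨v, hv, hr v⟩)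

theorem Crit.lt_card (hr : ∀ v, ¬ r v v) (h : Crit r m S) (hm : 0 < m) : m < #S := by
  obtain ⟨v, hv⟩ := h.nonempty hm
  exact (h.le_outDeg hr hv).trans_lt (outDeg_lt_card hr hv)

/-! ### Potential and arc counts -/

theorem sum_excess : ∑ v ∈ S, ((outDeg r S v : ℤ) - m) = - pot r m S := by
  simp [pot, arcs, mul_comm]

theorem Crit.pot_nonpos (hr : ∀ v, ¬ r v v) (h : Crit r m S) : pot r m S ≤ 0 := by
  have : 0 ≤ ∑ v ∈ S, ((outDeg r S v : ℤ) - m) :=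
    Finset.sum_nonneg fun v hv => by have := h.le_outDeg hr hv; omega
  rw [sum_excess] at this
  omega

theorem arcs_swap (A B : Finset V) : arcs (fun a b => r b a) A B = arcs r B A := by
  simp only [arcs, outDeg, card_filter]
  exact Finset.sum_comm

theorem pot_swap : pot (fun a b => r b a) m S = pot r m S := by
  rw [pot, pot, arcs_swap]

theorem outDeg_union {A B : Finset V} (h : Disjoint A B) (v : V) :
    outDeg r (A ∪ B) v = outDeg r A v + outDeg r B v := by
  rw [outDeg, filter_union, card_union_of_disjoint (disjoint_filter_filter h)]
  rfl

theorem arcs_union_left {A B C : Finset V} (h : Disjoint A B) :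
    arcs r (A ∪ B) C = arcs r A C + arcs r B C := sum_union h

theorem arcs_union_right {A B C : Finset V} (h : Disjoint A B) :
    arcs r C (A ∪ B) = arcs r C A + arcs r C B := by
  simp only [arcs, outDeg_union h, sum_add_distrib]

theorem arcs_union_self {A B : Finset V} (h : Disjoint A B) :
    arcs r (A ∪ B) (A ∪ B) = arcs r A A + arcs r A B + arcs r B A + arcs r B B := by
  rw [arcs_union_left h, arcs_union_right h, arcs_union_right h]
  ring

/-! ### Identification of vertices -/

/-- A dicolouring of an image of `r` under an identification with acyclic fibres lifts. -/
theorem IsCol.comp {α : Type*} {f : V → V} {φ : V → α}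
    (h : IsCol (collapse f r) (S.image f) φ) (hf : IsCol r S f) : IsCol r S (φ ∘ f) := by
  have key : ∀ a b, TransGen (Mono r S (φ ∘ f)) a b →
      (f a = f b ∧ TransGen (Mono r S f) a b) ∨
        TransGen (Mono (collapse f r) (S.image f) φ) (f a) (f b) := by
    have step : ∀ a b, Mono r S (φ ∘ f) a b → f a ≠ f b →
        Mono (collapse f r) (S.image f) φ (f a) (f b) := fun a b ⟨ha, hb, hab, e⟩ hne =>
      ⟨mem_image_of_mem f ha, mem_image_of_mem f hb, ⟨hne, a, b, hab, rfl, rfl⟩, e⟩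
    intro a b hab
    induction hab with
    | @single b h =>
      by_cases e : f a = f b
      · exact .inl ⟨e, .single ⟨h.1, h.2.1, h.2.2.1, e⟩⟩
      · exact .inr (.single (step _ _ h e))
    | @tail b c _ h ih =>
      by_cases e : f b = f c
      · rcases ih with ⟨e', ih⟩ | ih
        · exact .inl ⟨e'.trans e, ih.tail ⟨h.1, h.2.1, h.2.2.1, e⟩⟩
        · exact .inr (e ▸ ih)
      · rcases ih with ⟨e', ih⟩ | ih
        · exact .inr (e' ▸ .single (step _ _ h e))
        · exact .inr (ih.tail (step _ _ h e))
  intro v hv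
  rcases key v v hv with ⟨-, h'⟩ | h'
  · exact hf v h'
  · exact h _ h'

theorem collapse_irrefl {f : V → V} (v : V) : ¬ collapse f r v v := fun h => h.1 rfl

section Collapse

variable {f : V → V} {R W : Finset V} (hfR : ∀ u ∈ R, f u ∈ R) (hf : ∀ u ∉ R, f u = u)

include hfR hf

theorem collapse_of_notMem {a b : V} (ha : a ∉ R) (hb : b ∉ R) (h : collapse f r a b) : r a b := by
  obtain ⟨-, u, v, huv, rfl, rfl⟩ := h
  rwa [hf u fun h => ha (hfR u h), hf v fun h => hb (hfR v h)]

theorem outDeg_collapse_le {a : V} (ha : a ∉ R) {X : Finset V} (hX : X ⊆ R) :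
    outDeg (collapse f r) X a ≤ outDeg r R a := by
  refine (card_le_card (t := ({b ∈ R | r a b} : Finset V).image f) fun x hx => ?_).trans
    card_image_le
  obtain ⟨hxX, -, u, v, huv, rfl, rfl⟩ := mem_filter.1 hx
  have hv : v ∈ R := by
    by_contra hv
    exact hv (hf v hv ▸ hX hxX)
  rw [hf u fun h => ha (hfR u h)]
  rw [hf u fun h => ha (hfR u h)] at ha
  exact mem_image.2 ⟨v, mem_filter.2 ⟨hv, huv⟩, rfl⟩

/-- Replace `W ∩ R` by all of `R`: arcs of the collapse between `W \ R` and `W ∩ R` come from at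
least as many arcs between `W \ R` and `R`, and those inside `W \ R` are already arcs of `r`. -/
theorem pot_union_le_of_collapse :
    pot r m (R ∪ W) ≤ pot r m R + pot (collapse f r) m W - pot (collapse f r) m (W ∩ R) := by
  have hd : Disjoint (W ∩ R) (W \ R) := disjoint_sdiff_self_right.mono_left inter_subset_right
  have hd' : Disjoint R (W \ R) := disjoint_sdiff_self_right
  have hW : W = (W ∩ R) ∪ (W \ R) := by rw [union_comm, sdiff_union_inter]
  have hc := card_union_of_disjoint hd
  have hc' := card_union_of_disjoint hd'
  have ha := arcs_union_self (r := collapse f r) hd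
  have ha' := arcs_union_self (r := r) hd'
  rw [← hW] at hc ha
  rw [union_sdiff_self_eq_union] at hc' ha'
  have h1 : arcs (collapse f r) (W \ R) (W ∩ R) ≤ arcs r (W \ R) R :=
    sum_le_sum fun a h => outDeg_collapse_le hfR hf (mem_sdiff.1 h).2 inter_subset_right
  have h2 : arcs (collapse f r) (W ∩ R) (W \ R) ≤ arcs r R (W \ R) := by
    rw [← arcs_swap, ← arcs_swap (r := r)]
    have : (fun a b => collapse f r b a) = collapse f fun a b => r b a := by
      funext a b
      simp only [collapse, eq_iff_iff]
      exact ⟨fun ⟨h, u, v, h1, h2, h3⟩ => ⟨h.symm, v, u, h1, h3, h2⟩,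
        fun ⟨h, u, v, h1, h2, h3⟩ => ⟨h.symm, v, u, h1, h3, h2⟩⟩
    rw [this]
    exact sum_le_sum fun a h => outDeg_collapse_le hfR hf (mem_sdiff.1 h).2 inter_subset_right
  have h3 : arcs (collapse f r) (W \ R) (W \ R) ≤ arcs r (W \ R) (W \ R) := by
    refine sum_le_sum fun a h => card_le_card fun b hb => ?_
    rw [mem_filter] at hb ⊢
    exact ⟨hb.1, collapse_of_notMem hfR hf (mem_sdiff.1 h).2 (mem_sdiff.1 hb.1).2 hb.2⟩
  simp only [pot, hc, hc', ha, ha']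
  push_cast
  zify at h1 h2 h3
  linarith

/-- Away from `R` the collapse has only arcs of `r`, and proper subsets of `S` are dicolourable. -/
theorem Crit.inter_nonempty_of_collapse (h : Crit r m S) (hR : R ⊆ S) (hRne : R.Nonempty)
    (hWS : W ⊆ S) (hW : Crit (collapse f r) m W) : (W ∩ R).Nonempty := by
  by_contra hne
  rw [not_nonempty_iff_eq_empty, ← disjoint_iff_inter_eq_empty] at hne
  have hWne : W ≠ S := by
    rintro rfl
    obtain ⟨x, hx⟩ := hRne
    exact (disjoint_left.1 hne (hR hx)) hx
  exact hW.1 ((h.col_of_ssubset hWS hWne).mono Subset.rfl fun a ha b hb hab =>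
    collapse_of_notMem hfR hf (disjoint_left.1 hne ha) (disjoint_left.1 hne hb) hab)

end Collapse

/-! ### The gap lemma -/

theorem arcs_self_le (hr : ∀ v, ¬ r v v) : arcs r S S ≤ #S * (#S - 1) := by
  rw [← smul_eq_mul]
  exact sum_le_card_nsmul _ _ _ fun v hv => Nat.le_sub_one_of_lt (outDeg_lt_card hr hv)

/-- With `s` vertices the potential is at least `s (m + 1 - s)`, which is concave in `s` and equals
`m` at `s = 1` and `s = m`. -/
theorem le_pot_of_card_le (hr : ∀ v, ¬ r v v) (hS : S.Nonempty) (hc : #S ≤ m) :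
    (m : ℤ) ≤ pot r m S := by
  have h := arcs_self_le (S := S) hr
  have hpos := hS.card_pos
  obtain ⟨j, hj⟩ : ∃ j, #S = j + 1 := ⟨#S - 1, by omega⟩
  rw [hj, Nat.add_sub_cancel] at h
  obtain ⟨i, rfl⟩ := Nat.exists_eq_add_of_le hc
  rw [pot, hj]
  zify at h
  push_cast [hj]
  nlinarith [mul_nonneg (Int.natCast_nonneg i) (Int.natCast_nonneg j)]

/-- The gap lemma: proper subsets of a critical set have large potential. -/
theorem Crit.pot_add_le (hr : ∀ v, ¬ r v v) (hm : 0 < m) (h : Crit r m S) {R : Finset V}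
    (hR : R ⊆ S) (hne : R.Nonempty) (hRS : R ≠ S) : pot r m S + m ≤ pot r m R := by
  induction hn : #(S \ R) using Nat.strong_induction_on generalizing R with
  | _ n ih =>
  obtain ⟨φ, hφ⟩ := h.col_of_ssubset hR hRS
  have : Nonempty V := ⟨hne.choose⟩
  -- Each colour class in `R` goes to one representative, so the fibres are acyclic and at most `m`
  -- vertices of `R` survive.
  let f : V → V := fun u => if u ∈ R then Function.invFunOn φ (R : Set V) (φ u) else u
  have hex : ∀ u ∈ R, ∃ a ∈ (R : Set V), φ a = φ u := fun u hu => ⟨u, hu, rfl⟩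
  have hfu : ∀ u ∈ R, f u = Function.invFunOn φ (R : Set V) (φ u) := fun u hu => if_pos hu
  have hfR : ∀ u ∈ R, f u ∈ R := fun u hu => by
    rw [hfu u hu]
    exact Function.invFunOn_mem (hex u hu)
  have hf : ∀ u ∉ R, f u = u := fun u hu => if_neg hu
  have hφf : ∀ u ∈ R, φ (f u) = φ u := fun u hu => by
    rw [hfu u hu]
    exact Function.invFunOn_eq (hex u hu)
  have hfib : IsCol r S f := by
    intro v hv
    refine hφ v (transGen_imp ?_ hv)
    rintro a b ⟨-, -, hab, e⟩
    have hne : a ≠ b := fun e => hr a (e ▸ hab)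
    have hab' : a ∈ R ∧ b ∈ R := by
      by_cases ha : a ∈ R <;> by_cases hb : b ∈ R
      · exact ⟨ha, hb⟩
      · exact (hb (hf b hb ▸ e ▸ hfR a ha)).elim
      · exact (ha (hf a ha ▸ e ▸ hfR b hb)).elim
      · exact (hne (by rwa [hf a ha, hf b hb] at e)).elim
    exact ⟨hab'.1, hab'.2, hab, by rw [← hφf a hab'.1, ← hφf b hab'.2, e]⟩
  have hSf : S.image f ⊆ S := image_subset_iff.2 fun u hu => by
    by_cases huR : u ∈ R
    · exact hR (hfR u huR)
    · rwa [hf u huR]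
  obtain ⟨W, hW, hWc⟩ := exists_crit (r := collapse f r) (m := m) (S := S.image f)
    fun ⟨ψ, hψ⟩ => h.1 ⟨_, hψ.comp hfib⟩
  have hinter := h.inter_nonempty_of_collapse hfR hf hR hne (hW.trans hSf) hWc
  have hcard : #(W ∩ R) ≤ m := by
    have : Set.InjOn φ (W ∩ R : Finset V) := by
      have key : ∀ a ∈ W ∩ R, a = Function.invFunOn φ (R : Set V) (φ a) := by
        intro a ha
        obtain ⟨haW, haR⟩ := mem_inter.1 ha
        obtain ⟨u, -, rfl⟩ := mem_image.1 (hW haW)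
        have hu : u ∈ R := by
          by_contra hu
          exact hu (hf u hu ▸ haR)
        rw [hφf u hu, hfu u hu]
      intro a ha b hb e
      rw [key a ha, key b hb, e]
    simpa using Finset.card_le_card_of_injOn φ (t := univ) (fun _ _ => mem_univ _) this
  have h1 := pot_union_le_of_collapse (r := r) (m := m) (W := W) hfR hf
  have h2 := hWc.pot_nonpos collapse_irrefl
  have h3 := le_pot_of_card_le (r := collapse f r) (m := m) collapse_irrefl hinter hcard
  have hlt := hWc.lt_card collapse_irrefl hm
  have hsub : R ∪ W ⊆ S := union_subset hR (hW.trans hSf)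
  by_cases hRW : R ∪ W = S
  · rw [hRW] at h1
    linarith
  -- `R ∪ W` is still proper but strictly larger than `R`, because `W` has more than `m` vertices;
  -- induction applies to it.
  · have hWR : ¬ W ⊆ R := fun hWR => by
      rw [inter_eq_left.2 hWR] at hcard
      omega
    have hss : S \ (R ∪ W) ⊂ S \ R := by
      obtain ⟨x, hxW, hxR⟩ := not_subset.1 hWR
      refine Finset.ssubset_iff_subset_ne.2 ⟨sdiff_subset_sdiff Subset.rfl subset_union_left, ?_⟩
      intro e
      have hx : x ∈ S \ R := mem_sdiff.2 ⟨hSf (hW hxW), hxR⟩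
      rw [← e] at hx
      exact (mem_sdiff.1 hx).2 (mem_union_right _ hxW)
    have := ih _ (hn ▸ card_lt_card hss) hsub (hne.mono subset_union_left) hRW rfl
    linarith [(Nat.cast_nonneg m : (0 : ℤ) ≤ m)]

/-! ### Complete sets and low vertices -/

/-- All arcs between distinct vertices of `Q` are present. -/
def IsComplete (r : V → V → Prop) (Q : Finset V) : Prop :=
  ∀ a ∈ Q, ∀ b ∈ Q, a ≠ b → r a b

theorem IsComplete.swap {Q : Finset V} (h : IsComplete r Q) :
    IsComplete (fun a b => r b a) Q := fun a ha b hb hab => h b hb a ha hab.symm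

theorem IsComplete.outDeg_add_one {Q : Finset V} (hr : ∀ v, ¬ r v v) (h : IsComplete r Q) {q : V}
    (hq : q ∈ Q) : outDeg r Q q + 1 = #Q := by
  rw [← card_erase_add_one hq, outDeg]
  congr 2
  ext b
  rw [mem_filter, mem_erase]
  exact ⟨fun hb => ⟨fun e => hr q (e ▸ hb.2), hb.1⟩, fun hb => ⟨hb.2, h q hq b hb.2 hb.1.symm⟩⟩

/-- A set with a complete subset of `m + 1` vertices is not `m`-dicolourable. -/
theorem IsComplete.not_col (h : IsComplete r T) (hT : m < #T) : ¬ Col r m T := by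
  rintro ⟨φ, hφ⟩
  obtain ⟨a, ha, b, hb, hab, e⟩ := Finset.exists_ne_map_eq_of_card_lt_of_maps_to
    (s := T) (t := (univ : Finset (Fin m))) (by simpa using hT) (f := φ) fun _ _ => mem_univ _
  exact hφ a (.tail (.single ⟨ha, hb, h a ha b hb hab, e⟩) ⟨hb, ha, h b hb a ha hab.symm, e.symm⟩)

theorem outDeg_mono {A B : Finset V} (h : A ⊆ B) (v : V) : outDeg r A v ≤ outDeg r B v :=
  card_le_card (filter_subset_filter _ h)

theorem sum_excess_le (hr : ∀ v, ¬ r v v) (h : Crit r m S) {A : Finset V} (hA : A ⊆ S) :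
    ∑ v ∈ A, ((outDeg r S v : ℤ) - m) ≤ - pot r m S := by
  rw [← sum_excess]
  refine sum_le_sum_of_subset_of_nonneg hA fun v hv _ => ?_
  have := h.le_outDeg hr hv
  omega

/-- The vertices of `A` of smallest possible out-degree. -/
noncomputable def low (r : V → V → Prop) (m : ℕ) (S A : Finset V) : Finset V :=
  {v ∈ A | outDeg r S v = m}

/-- A vertex that is not low contributes at least one to the excess. -/
theorem card_sub_card_low_le (hr : ∀ v, ¬ r v v) (h : Crit r m S) {A : Finset V} (hA : A ⊆ S) :
    (#A : ℤ) - #(low r m S A) ≤ ∑ v ∈ A, ((outDeg r S v : ℤ) - m) := by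
  have h2 : (#{v ∈ A | ¬ outDeg r S v = m} : ℤ) ≤ ∑ v ∈ A, ((outDeg r S v : ℤ) - m) := by
    rw [card_filter]
    push_cast
    refine sum_le_sum fun v hv => ?_
    have := h.le_outDeg hr (hA hv)
    split_ifs <;> omega
  have h3 := card_filter_add_card_filter_not (s := A) (fun v => outDeg r S v = m)
  rw [low]
  omega

theorem card_le_card_low (hr : ∀ v, ¬ r v v) (h : Crit r m S) {A : Finset V} (hA : A ⊆ S) :
    (#A : ℤ) ≤ #(low r m S A) - pot r m S := by
  have h1 := sum_excess_le hr h hA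
  have h2 := card_sub_card_low_le hr h hA
  omega

/-- The total excess `-pot` pays for `y` and for the non-low vertices of `A` together. -/
theorem outDeg_add_card_le (hr : ∀ v, ¬ r v v) (h : Crit r m S) {A : Finset V} (hA : A ⊆ S)
    {y : V} (hy : y ∈ S) (hyA : y ∉ A) :
    (outDeg r S y : ℤ) + #A ≤ m + #(low r m S A) - pot r m S := by
  have h1 := sum_excess_le hr h (insert_subset hy hA)
  rw [sum_insert hyA] at h1
  have h2 := card_sub_card_low_le hr h hA
  omega

/-! ### The apex of a complete set -/

/-- Two vertices of a proper subset can be given different colours. -/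
theorem Crit.exists_isCol_ne (hr : ∀ v, ¬ r v v) (hm : 0 < m) (h : Crit r m S)
    (hpot : 3 ≤ pot r m S + m) (hT : T ⊆ S) (hTS : T ≠ S) {x z : V} (hx : x ∈ T) (hz : z ∈ T)
    (hxz : x ≠ z) : ∃ φ : V → Fin m, IsCol r T φ ∧ φ x ≠ φ z := by
  -- A 2-cycle on `x`, `z` forces distinct colours. If it prevents a dicolouring, some critical
  -- subset has potential at most `0` with the two new arcs, so at most `2` without them, against
  -- the gap bound of at least `3`.
  obtain ⟨r', hdef⟩ : ∃ r' : V → V → Prop,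
      ∀ a b, r' a b ↔ r a b ∨ (a = x ∧ b = z) ∨ (a = z ∧ b = x) := ⟨_, fun _ _ => Iff.rfl⟩
  have hr' : ∀ v, ¬ r' v v := by
    intro v hv
    rcases (hdef v v).1 hv with hv | ⟨rfl, hv⟩ | ⟨rfl, hv⟩
    exacts [hr v hv, hxz hv, hxz hv.symm]
  by_cases hc : Col r' m T
  · obtain ⟨φ, hφ⟩ := hc
    refine ⟨φ, hφ.mono Subset.rfl fun a _ b _ h => (hdef a b).2 (.inl h), fun e => hφ x ?_⟩
    exact .tail (.single ⟨hx, hz, (hdef x z).2 (.inr (.inl ⟨rfl, rfl⟩)), e⟩)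
      ⟨hz, hx, (hdef z x).2 (.inr (.inr ⟨rfl, rfl⟩)), e.symm⟩
  · exfalso
    obtain ⟨W, hWT, hW⟩ := exists_crit hc
    have h1 := hW.pot_nonpos hr'
    have hWS : W ≠ S := fun e => hTS (hT.antisymm (e ▸ hWT))
    have h2 := h.pot_add_le hr hm (hWT.trans hT) (hW.nonempty hm) hWS
    have h3 : arcs r' W W ≤ arcs r W W + 2 := by
      have key : ∀ r : V → V → Prop, arcs r W W = #{p ∈ W ×ˢ W | r p.1 p.2} := fun r => by
        simp only [arcs, outDeg, card_filter, sum_product]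
      rw [key, key]
      calc _ ≤ #(({p ∈ W ×ˢ W | r p.1 p.2} : Finset (V × V)) ∪ {(x, z), (z, x)}) := by
            refine card_le_card ?_
            rintro ⟨a, b⟩ hp
            obtain ⟨hp, hab⟩ := mem_filter.1 hp
            rcases (hdef a b).1 hab with hab | ⟨rfl, rfl⟩ | ⟨rfl, rfl⟩
            · exact mem_union_left _ (mem_filter.2 ⟨hp, hab⟩)
            · simp
            · simp
        _ ≤ _ := (card_union_le _ _).trans (Nat.add_le_add_left card_le_two _)
    rw [pot] at h1 h2
    rw [pot] at h2
    zify at h3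
    rw [pot] at hpot
    linarith

/-- In any dicolouring of the complement of a complete set `Q` of `m` vertices, some colour is
forbidden at all vertices of `Q`. -/
theorem Crit.exists_common_colour (hr : ∀ v, ¬ r v v) (h : Crit r m S)
    (hpot : 3 ≤ pot r m S + m) {Q : Finset V} (hQS : Q ⊆ S) (hQ : IsComplete r Q) (hQm : #Q = m)
    {φ : V → Fin m} (hφ : IsCol r (S \ Q) φ) :
    ∃ c, ∀ q ∈ Q, (∃ b ∈ S \ Q, r q b ∧ φ b = c) ∧ ∃ a ∈ S \ Q, r a q ∧ φ a = c := by
  obtain ⟨F, hF⟩ : ∃ F : V → Fin m → Prop, ∀ q c, F q c ↔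
      (∃ b ∈ S \ Q, r q b ∧ φ b = c) ∧ ∃ a ∈ S \ Q, r a q ∧ φ a = c := ⟨_, fun _ _ => Iff.rfl⟩
  -- `t q` lists the colours usable at `q`. Distinct choices from these lists would colour `S`, so
  -- Hall's condition fails.
  let t : Q → Finset (Fin m) := fun q => {c | ¬ F q c}
  by_cases hall : ∀ s : Finset Q, #s ≤ #(s.biUnion t)
  · exfalso
    obtain ⟨g, hg, hgt⟩ := (Finset.all_card_le_biUnion_card_iff_exists_injective t).1 hall
    refine h.1 ⟨fun v => if hv : v ∈ Q then g ⟨v, hv⟩ else φ v, isCol_extend (Q := Q) hφ ?_ ?_⟩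
    · intro a _ ha
      exact dif_neg ha
    · intro q hq a ha b hb haq hqb ea eb
      have aux : ∀ x, x ≠ q →
          (if hx : x ∈ Q then g ⟨x, hx⟩ else φ x) = (if hq : q ∈ Q then g ⟨q, hq⟩ else φ q) →
          x ∉ Q ∧ φ x = g ⟨q, hq⟩ := by
        intro x hxq e
        rw [dif_pos hq] at e
        by_cases hx : x ∈ Q
        · rw [dif_pos hx] at e
          exact (hxq (congrArg Subtype.val (hg e))).elim
        · rw [dif_neg hx] at e
          exact ⟨hx, e⟩
      obtain ⟨ha', ea⟩ := aux a (fun e => hr q (by rwa [e] at haq)) ea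
      obtain ⟨hb', eb⟩ := aux b (fun e => hr q (by rwa [e] at hqb)) eb
      have := (mem_filter.1 (hgt ⟨q, hq⟩)).2
      exact this ((hF _ _).2
        ⟨⟨b, mem_sdiff.2 ⟨hb, hb'⟩, hqb, eb⟩, a, mem_sdiff.2 ⟨ha, ha'⟩, haq, ea⟩)
  · push Not at hall
    obtain ⟨s, hs⟩ := hall
    -- A vertex of the Hall violator has fewer than `#s` usable colours, hence more than `m - #s`
    -- out-neighbours outside `Q`, besides `m - 1` inside.
    have hdeg : ∀ q ∈ s, (m : ℤ) - #s ≤ (outDeg r S q : ℤ) - m := by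
      intro q hq
      have h1 : m ≤ outDeg r (S \ Q) q + #(t q) := by
        have h2 : #{c | F q c} + #{c | ¬ F q c} = m := by
          rw [card_filter_add_card_filter_not, card_univ, Fintype.card_fin]
        have h3 : #{c | F q c} ≤ outDeg r (S \ Q) q := by
          refine (card_le_card fun c hc => ?_).trans (card_image_le (f := φ))
          obtain ⟨⟨b, hb, hqb, e⟩, -⟩ := (hF _ _).1 (mem_filter.1 hc).2
          exact mem_image.2 ⟨b, mem_filter.2 ⟨hb, hqb⟩, e⟩
        have h4 : #(t q) = #{c | ¬ F q c} := rfl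
        omega
      have h2 : #(t q) < #s := (card_le_card (subset_biUnion_of_mem t hq)).trans_lt hs
      have h3 := outDeg_union (r := r) (disjoint_sdiff (s := Q) (t := S)) (q : V)
      rw [union_sdiff_of_subset hQS] at h3
      have h4 := hQ.outDeg_add_one hr q.2
      omega
    have hsm : #s ≤ m := by
      have := card_le_univ s
      rwa [Fintype.card_coe, hQm] at this
    have hsum : (#s : ℤ) * (m - #s) ≤ - pot r m S := by
      refine le_trans ?_ (sum_excess_le hr h (A := s.map (Function.Embedding.subtype _)) ?_)
      · rw [sum_map, ← nsmul_eq_mul]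
        exact card_nsmul_le_sum _ _ _ hdeg
      · intro x hx
        obtain ⟨y, -, rfl⟩ := mem_map.1 hx
        exact hQS y.2
    have hs0 : 0 < #s := by omega
    -- For `0 < #s < m` the product `#s * (m - #s)` is at least `m - 1`, while the excess is at most
    -- `m - 3`.
    have hsm' : #s = m := by
      by_contra hne
      obtain ⟨i, hi⟩ := Nat.exists_eq_add_of_lt (lt_of_le_of_ne hsm hne)
      obtain ⟨j, hj⟩ := Nat.exists_eq_add_of_lt hs0
      rw [hi, hj] at hsum
      push_cast at hsum
      rw [hi, hj] at hpot
      push_cast at hpot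
      nlinarith [mul_nonneg (Int.natCast_nonneg i) (Int.natCast_nonneg j)]
    have hsu : s = univ := by
      rw [← card_eq_iff_eq_univ, Fintype.card_coe, hQm, hsm']
    obtain ⟨c, hc⟩ : ∃ c, c ∉ s.biUnion t := by
      by_contra! hall
      have := Finset.card_le_card (fun c _ => hall c : univ ⊆ _)
      rw [Finset.card_univ, Fintype.card_fin] at this
      omega
    refine ⟨c, fun q hq => ?_⟩
    by_contra hq'
    rw [← hF] at hq'
    exact hc (mem_biUnion.2 ⟨⟨q, hq⟩, hsu ▸ mem_univ _, mem_filter.2 ⟨mem_univ _, hq'⟩⟩)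

theorem IsComplete.exists_unique_out (hr : ∀ v, ¬ r v v) {Q : Finset V} (hQS : Q ⊆ S)
    (hQ : IsComplete r Q) (hQm : #Q = m) {q : V} (hq : q ∈ low r m S Q) :
    ∃ x ∈ S \ Q, r q x ∧ ∀ b ∈ S \ Q, r q b → b = x := by
  obtain ⟨hqQ, hq⟩ := mem_filter.1 hq
  have h3 := outDeg_union (r := r) (disjoint_sdiff (s := Q) (t := S)) (q : V)
  rw [union_sdiff_of_subset hQS, hq] at h3
  have h4 := hQ.outDeg_add_one hr hqQ
  obtain ⟨x, hx⟩ := card_eq_one.1 (show #{b ∈ S \ Q | r q b} = 1 by unfold outDeg at *; omega)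
  have hx' : x ∈ ({b ∈ S \ Q | r q b} : Finset V) := hx ▸ mem_singleton_self x
  obtain ⟨h5, h6⟩ := mem_filter.1 hx'
  refine ⟨x, h5, h6, fun b hb hqb => ?_⟩
  rw [← mem_singleton, ← hx]
  exact mem_filter.2 ⟨hb, hqb⟩

/-- All low vertices of a complete set of `m` vertices have the same neighbour outside. -/
theorem Crit.exists_apex (hr : ∀ v, ¬ r v v) (h : Crit r m S) (hm : 0 < m)
    (hpot : 3 ≤ pot r m S + m) {Q : Finset V} (hQS : Q ⊆ S) (hQ : IsComplete r Q)
    (hQm : #Q = m) :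
    ∃ x ∈ S \ Q,
      (∀ q ∈ low r m S Q, r q x ∧ ∀ b ∈ S \ Q, r q b → b = x) ∧
      (∀ q ∈ low (fun a b => r b a) m S Q, r x q ∧ ∀ b ∈ S \ Q, r b q → b = x) := by
  have h0 := card_le_card_low hr h hQS
  obtain ⟨p, hp⟩ : (low r m S Q).Nonempty := card_pos.1 (by omega)
  obtain ⟨x, hx, hpx, hpu⟩ := hQ.exists_unique_out hr hQS hQm hp
  have hne : S \ Q ≠ S := by
    intro e
    have hpQ := (mem_filter.1 hp).1
    rw [Finset.sdiff_eq_self_iff_disjoint] at e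
    exact disjoint_left.1 e (hQS hpQ) hpQ
  -- The colour forbidden on all of `Q` is always that of `x`, and likewise that of the outside
  -- neighbour of any other low vertex. Only `x` itself always agrees with `x`.
  have key : ∀ z ∈ S \ Q, (∀ φ : V → Fin m, IsCol r (S \ Q) φ → φ x = φ z) → z = x := by
    intro z hz hφ
    by_contra hzx
    obtain ⟨φ, h1, h2⟩ := h.exists_isCol_ne hr hm hpot sdiff_subset hne hx hz (Ne.symm hzx)
    exact h2 (hφ φ h1)
  have hcol : ∀ φ : V → Fin m, IsCol r (S \ Q) φ →
      ∀ q ∈ Q, (∃ b ∈ S \ Q, r q b ∧ φ b = φ x) ∧ ∃ a ∈ S \ Q, r a q ∧ φ a = φ x := by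
    intro φ hφ
    obtain ⟨c, hc⟩ := h.exists_common_colour hr hpot hQS hQ hQm hφ
    obtain ⟨⟨b, hb, hpb, e⟩, -⟩ := hc p (mem_filter.1 hp).1
    rw [hpu b hb hpb] at e
    exact e ▸ hc
  refine ⟨x, hx, fun q hq => ?_, fun q hq => ?_⟩
  · obtain ⟨z, hz, hqz, hqu⟩ := hQ.exists_unique_out hr hQS hQm hq
    obtain rfl := key z hz fun φ hφ => by
      obtain ⟨⟨b, hb, hqb, e⟩, -⟩ := hcol φ hφ q (mem_filter.1 hq).1
      rw [← e, hqu b hb hqb]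
    exact ⟨hqz, hqu⟩
  · obtain ⟨z, hz, hqz, hqu⟩ := hQ.swap.exists_unique_out (r := fun a b => r b a) (fun v => hr v) hQS hQm hq
    obtain rfl := key z hz fun φ hφ => by
      obtain ⟨-, b, hb, hqb, e⟩ := hcol φ hφ q (mem_filter.1 hq).1
      rw [← e, hqu b hb hqb]
    exact ⟨hqz, hqu⟩

/-! ### Identification at a low vertex -/

/-- Identifying two out-neighbours of a low vertex produces a complete set of `m` vertices. -/
theorem Crit.exists_complete_of_low (hr : ∀ v, ¬ r v v) (h : Crit r m S) (hm : 0 < m)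
    (ih : ∀ (r' : V → V → Prop) (W : Finset V), #W < #S → (∀ v, ¬ r' v v) → Crit r' m W →
      (#W = m + 1 ∧ IsComplete r' W) ∨ pot r' m W < pot r m S)
    {v x y : V} (hv : v ∈ S) (hlow : outDeg r S v = m) (hx : x ∈ S) (hy : y ∈ S)
    (hvx : r v x) (hvy : r v y) (hxy : x ≠ y) (hn : ¬ (r x y ∧ r y x)) :
    ∃ Q ⊆ S, #Q = m ∧ IsComplete r Q ∧ v ∉ Q ∧ x ∉ Q ∧ y ∉ Q ∧
      ∀ q ∈ Q, (r q x ∨ r q y) ∧ (r x q ∨ r y q) := by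
  let f : V → V := fun u => if u = y then x else u
  have hfy : f y = x := if_pos rfl
  have hfne : ∀ u, u ≠ y → f u = u := fun u hu => if_neg hu
  have hne_y : ∀ u, f u ≠ y := fun u => by
    by_cases hu : u = y
    · rw [hu, hfy]
      exact hxy
    · rwa [hfne u hu]
  have hvx' : v ≠ x := fun e => hr v (by rwa [← e] at hvx)
  have hvy' : v ≠ y := fun e => hr v (by rwa [← e] at hvy)
  have hfR : ∀ u ∈ ({x, y} : Finset V), f u ∈ ({x, y} : Finset V) := by
    intro u hu
    rcases mem_insert.1 hu with rfl | hu
    · rw [hfne _ hxy]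
      exact hu
    · rw [mem_singleton.1 hu, hfy]
      exact mem_insert_self _ _
  have hf : ∀ u ∉ ({x, y} : Finset V), f u = u := fun u hu =>
    hfne u fun e => hu (by simp [e])
  have hfib : ∀ a b, r a b → f a = f b → (a = x ∧ b = y) ∨ (a = y ∧ b = x) := by
    intro a b hab e
    by_cases ha : a = y <;> by_cases hb : b = y
    · subst ha hb
      exact (hr _ hab).elim
    · subst ha
      rw [hfy, hfne b hb] at e
      exact .inr ⟨rfl, e.symm⟩
    · subst hb
      rw [hfy, hfne a ha] at e
      exact .inl ⟨e, rfl⟩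
    · rw [hfne a ha, hfne b hb] at e
      exact (hr a (e ▸ hab)).elim
  have hfcol : IsCol r (S.erase v) f := by
    intro w hw
    have hnone : ∀ a b c, Mono r (S.erase v) f a b → Mono r (S.erase v) f b c → False := by
      rintro a b c ⟨-, -, hab, e⟩ ⟨-, -, hbc, e'⟩
      rcases hfib a b hab e with ⟨rfl, rfl⟩ | ⟨rfl, rfl⟩ <;>
        rcases hfib _ c hbc e' with ⟨h1, rfl⟩ | ⟨h1, rfl⟩
      · exact hxy h1.symm
      · exact hn ⟨hab, hbc⟩
      · exact hn ⟨hbc, hab⟩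
      · exact hxy h1
    obtain ⟨a, -, ha⟩ := TransGen.tail'_iff.1 hw
    obtain ⟨b, hb, -⟩ := TransGen.head'_iff.1 hw
    exact hnone _ _ _ ha hb
  have hncol : ¬ Col (collapse f r) m ((S.erase v).image f) := by
    rintro ⟨ψ, hψ⟩
    have hφ := hψ.comp hfcol
    have hxyφ : (ψ ∘ f) x = (ψ ∘ f) y := by simp [hfy, hfne x hxy]
    -- The vertices `x` and `y` share a colour, so the `m` out-neighbours of `v` use at most `m - 1`
    -- colours.
    obtain ⟨c, hc⟩ : ∃ c, c ∉ (({b ∈ S | r v b} : Finset V).erase y).image (ψ ∘ f) := by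
      by_contra! hall
      have h1 := Finset.card_le_card (fun c _ => hall c : univ ⊆ _)
      rw [Finset.card_univ, Fintype.card_fin] at h1
      have h2 := h1.trans card_image_le
      have hy' : y ∈ ({b ∈ S | r v b} : Finset V) := mem_filter.2 ⟨hy, hvy⟩
      have h3 := card_erase_add_one hy'
      rw [outDeg] at hlow
      omega
    refine h.1 (col_of_missing_colour hr hφ (c := c) fun b hb hvb e => hc ?_)
    by_cases hby : b = y
    · subst hby
      exact mem_image.2 ⟨x, by simp [hx, hvx, hxy], hxyφ.trans e⟩
    · exact mem_image.2 ⟨b, by simp [hb, hvb, hby], e⟩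
  obtain ⟨W, hW, hWc⟩ := exists_crit hncol
  have hWS : W ⊆ S.erase v := hW.trans <| image_subset_iff.2 fun u hu => by
    by_cases huy : u = y
    · rw [huy, hfy]
      exact mem_erase.2 ⟨hvx'.symm, hx⟩
    · rwa [hfne u huy]
  have hyW : y ∉ W := fun hyW => by
    obtain ⟨u, -, hu⟩ := mem_image.1 (hW hyW)
    exact hne_y u hu
  have hRS : ({x, y} : Finset V) ⊆ S.erase v := by
    intro u hu
    rcases mem_insert.1 hu with rfl | hu
    · exact mem_erase.2 ⟨hvx'.symm, hx⟩
    · rw [mem_singleton.1 hu]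
      exact mem_erase.2 ⟨hvy'.symm, hy⟩
  have hinter := h.inter_nonempty_of_collapse hfR hf (hRS.trans (erase_subset _ _))
    (insert_nonempty _ _) (hWS.trans (erase_subset _ _)) hWc
  have hxW : x ∈ W := by
    obtain ⟨u, hu⟩ := hinter
    obtain ⟨huW, huR⟩ := mem_inter.1 hu
    rcases mem_insert.1 huR with e | e
    · exact e ▸ huW
    · exact (hyW (mem_singleton.1 e ▸ huW)).elim
  have hWR : W ∩ {x, y} = {x} := by
    ext u
    simp only [mem_inter, mem_insert, mem_singleton]
    constructor
    · rintro ⟨hu, rfl | rfl⟩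
      exacts [rfl, (hyW hu).elim]
    · rintro rfl
      exact ⟨hxW, .inl rfl⟩
  have h1 := pot_union_le_of_collapse (r := r) (m := m) (W := W) hfR hf
  have h2 : pot (collapse f r) m ({x} : Finset V) = m := by
    simp [pot, arcs, outDeg, filter_singleton, collapse_irrefl]
  have h3 : pot r m ({x, y} : Finset V) ≤ 2 * m := by
    rw [pot, card_pair hxy]
    push_cast
    linarith [(Nat.cast_nonneg (arcs r {x, y} {x, y}) : (0 : ℤ) ≤ _)]
  -- Since `{x, y} ∪ W` omits `v`, its potential is at least `pot r m S + m`; by `h1`, `h2`, `h3` it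
  -- is at most the potential of `W` plus `m`. So `W` cannot fall in the second case of `ih`.
  have h4 := h.pot_add_le hr hm (R := {x, y} ∪ W)
    ((union_subset hRS hWS).trans (erase_subset _ _)) ⟨x, mem_union_right _ hxW⟩ fun e => by
      have := union_subset hRS hWS
      rw [e] at this
      exact notMem_erase v S (this hv)
  rw [hWR, h2] at h1
  have hcard : #W < #S := (card_le_card hWS).trans_lt (card_lt_card (erase_ssubset hv))
  rcases ih _ W hcard collapse_irrefl hWc with ⟨hWm, hWcomp⟩ | hlt
  swap
  · linarith
  have hQne : ∀ q ∈ W.erase x, q ∉ ({x, y} : Finset V) := by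
    intro q hq
    rw [mem_erase] at hq
    simp only [mem_insert, mem_singleton, not_or]
    exact ⟨hq.1, fun e => hyW (e ▸ hq.2)⟩
  have hcases : ∀ u, f u = x → u = x ∨ u = y := fun u hu => by
    by_cases huy : u = y
    · exact .inr huy
    · exact .inl (by rwa [hfne u huy] at hu)
  refine ⟨W.erase x, (erase_subset _ _).trans (hWS.trans (erase_subset _ _)), ?_, ?_, ?_,
    notMem_erase _ _, fun hy => hyW (mem_of_mem_erase hy), ?_⟩
  · rw [card_erase_of_mem hxW, hWm]
    rfl
  · intro a ha b hb hab
    exact collapse_of_notMem hfR hf (hQne a ha) (hQne b hb)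
      (hWcomp a (mem_of_mem_erase ha) b (mem_of_mem_erase hb) hab)
  · exact fun hvW => notMem_erase v S (hWS (mem_of_mem_erase hvW))
  · intro q hq
    have hfq : ∀ u, f u = q → u = q := fun u hu => by
      by_contra hne
      by_cases huy : u = y
      · rw [huy, hfy] at hu
        exact (mem_erase.1 hq).1 hu.symm
      · exact hne (by rwa [hfne u huy] at hu)
    constructor
    · obtain ⟨-, u, w, huw, hu, hw⟩ := hWcomp q (mem_of_mem_erase hq) x hxW (mem_erase.1 hq).1
      obtain rfl := hfq u hu
      rcases hcases w hw with rfl | rfl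
      exacts [.inl huw, .inr huw]
    · obtain ⟨-, u, w, huw, hu, hw⟩ :=
        hWcomp x hxW q (mem_of_mem_erase hq) (mem_erase.1 hq).1.symm
      obtain rfl := hfq w hw
      rcases hcases u hu with rfl | rfl
      exacts [.inl huw, .inr huw]

theorem Crit.eq_of_isComplete (h : Crit r m S) (hT : T ⊆ S) (hTc : IsComplete r T)
    (hTm : m < #T) : T = S := by
  by_contra hne
  exact hTc.not_col hTm (h.col_of_ssubset hT hne)

/-- The out-neighbourhood of a low vertex has exactly `m` vertices: either it is complete, or it
contains a pair to identify. -/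
theorem Crit.exists_isComplete (hr : ∀ v, ¬ r v v) (h : Crit r m S) (hm : 0 < m)
    (ih : ∀ (r' : V → V → Prop) (W : Finset V), #W < #S → (∀ v, ¬ r' v v) → Crit r' m W →
      (#W = m + 1 ∧ IsComplete r' W) ∨ pot r' m W < pot r m S)
    (hpot : 3 ≤ pot r m S + m) : ∃ Q ⊆ S, #Q = m ∧ IsComplete r Q := by
  have h0 := card_le_card_low hr h Subset.rfl
  have h1 := h.lt_card hr hm
  obtain ⟨v, hv⟩ : (low r m S S).Nonempty := card_pos.1 (by omega)
  obtain ⟨hv, hlow⟩ := mem_filter.1 hv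
  by_cases hc : IsComplete r {b ∈ S | r v b}
  · exact ⟨_, filter_subset _ _, hlow, hc⟩
  · have : ∃ x ∈ S, ∃ y ∈ S, r v x ∧ r v y ∧ x ≠ y ∧ ¬ (r x y ∧ r y x) := by
      by_contra! hall
      refine hc fun a ha b hb hab => ?_
      rw [mem_filter] at ha hb
      exact (hall a ha.1 b hb.1 ha.2 hb.2 hab).1
    obtain ⟨x, hx, y, hy, hvx, hvy, hxy, hn⟩ := this
    obtain ⟨Q, hQ, hQm, hQc, -⟩ :=
      h.exists_complete_of_low hr hm ih hv hlow hx hy hvx hvy hxy hn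
    exact ⟨Q, hQ, hQm, hQc⟩

theorem low_subset (A : Finset V) : low r m S A ⊆ A := filter_subset _ _

/-! ### Counting around two complete sets -/

/-- Two intersecting complete sets of `m` vertices produce too many arcs. -/
theorem Crit.disjoint_of_isComplete (hr : ∀ v, ¬ r v v) (h : Crit r m S)
    (hpot : 3 ≤ pot r m S + m) {P Q : Finset V} (hP : P ⊆ S) (hQ : Q ⊆ S) (hPm : #P = m)
    (hQm : #Q = m) (hPc : IsComplete r P) (hQc : IsComplete r Q) (hPQ : #(P ∩ Q) + 2 ≤ m) :
    Disjoint P Q := by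
  rw [disjoint_iff_inter_eq_empty, ← Finset.card_eq_zero]
  by_contra hne
  -- A common vertex sees all the rest of `P ∪ Q`. With `i = #(P ∩ Q)` this costs `i (m - 1 - i)`,
  -- at least `m - 2` for `1 ≤ i ≤ m - 2`, but the excess is at most `m - 3`.
  have hdeg : ∀ z ∈ P ∩ Q, (m : ℤ) - 1 - #(P ∩ Q) ≤ (outDeg r S z : ℤ) - m := by
    intro z hz
    obtain ⟨hzP, hzQ⟩ := mem_inter.1 hz
    have h1 : #((P ∪ Q).erase z) ≤ outDeg r S z := by
      refine card_le_card fun b hb => ?_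
      obtain ⟨hbz, hb⟩ := mem_erase.1 hb
      rcases mem_union.1 hb with hb | hb
      · exact mem_filter.2 ⟨hP hb, hPc z hzP b hb hbz.symm⟩
      · exact mem_filter.2 ⟨hQ hb, hQc z hzQ b hb hbz.symm⟩
    have h2 := card_erase_add_one (mem_union_left Q hzP)
    have h3 := card_union_add_card_inter P Q
    omega
  have hsum := (card_nsmul_le_sum _ _ _ hdeg).trans
    (sum_excess_le hr h (inter_subset_left.trans hP))
  rw [nsmul_eq_mul] at hsum
  obtain ⟨i, hi⟩ := Nat.exists_eq_add_of_le' hPQ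
  obtain ⟨j, hj⟩ := Nat.exists_eq_succ_of_ne_zero hne
  rw [hi, hj] at hsum
  rw [hi, hj] at hpot
  push_cast at hsum hpot
  nlinarith [mul_nonneg (Int.natCast_nonneg i) (Int.natCast_nonneg j)]

theorem card_low_le_outDeg {A : Finset V} (hA : A ⊆ S) {y : V}
    (hy : ∀ q ∈ low (fun a b => r b a) m S A, r y q) :
    #(low (fun a b => r b a) m S A) ≤ outDeg r S y :=
  card_le_card fun q hq => mem_filter.2 ⟨hA (low_subset _ hq), hy q hq⟩

/-- A critical set which is not complete has at least `m - 2` arcs in excess. -/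
theorem Crit.isComplete_or_pot_le (hm : 3 ≤ m) (hr : ∀ v, ¬ r v v) (h : Crit r m S) :
    (#S = m + 1 ∧ IsComplete r S) ∨ pot r m S ≤ 2 - m := by
  induction hn : #S using Nat.strong_induction_on generalizing r S with
  | _ n ih =>
  subst hn
  by_contra! hcon
  obtain ⟨hnc, hpot⟩ := hcon
  have hm0 : 0 < m := by omega
  have hpot3 : 3 ≤ pot r m S + m := by omega
  have ih' : ∀ (r' : V → V → Prop) (W : Finset V), #W < #S → (∀ v, ¬ r' v v) → Crit r' m W →
      (#W = m + 1 ∧ IsComplete r' W) ∨ pot r' m W < pot r m S := by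
    intro r' W hW hr' hWc
    exact (ih _ hW hr' hWc rfl).imp_right fun h => h.trans_lt hpot
  obtain ⟨Q, hQ, hQm, hQc⟩ := h.exists_isComplete hr hm0 ih' hpot3
  obtain ⟨x, hx, hxout, hxin⟩ := h.exists_apex hr hm0 hpot3 hQ hQc hQm
  obtain ⟨hxS, hxQ⟩ := mem_sdiff.1 hx
  obtain ⟨q, hq, hqx⟩ : ∃ q ∈ Q, ¬ (r x q ∧ r q x) := by
    by_contra! hall
    have hcomp : IsComplete r (insert x Q) := by
      intro a ha b hb hab
      rcases mem_insert.1 ha with rfl | haQ <;> rcases mem_insert.1 hb with rfl | hbQ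
      · exact (hab rfl).elim
      · exact (hall b hbQ).1
      · exact (hall a haQ).2
      · exact hQc a haQ b hbQ hab
    have hcard : #(insert x Q) = m + 1 := by rw [card_insert_of_notMem hxQ, hQm]
    have := h.eq_of_isComplete (insert_subset hxS hQ) hcomp (by omega)
    rw [this] at hcard hcomp
    exact hnc hcard hcomp
  have hqS := hQ hq
  -- At least `m + pot r m S ≥ 3` vertices of `Q` are low, so one differs from `q`.
  obtain ⟨u, hu, huq⟩ : ∃ u ∈ low r m S Q, u ≠ q := by
    have h0 := card_le_card_low hr h hQ
    exact Finset.exists_mem_ne (by omega) q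
  obtain ⟨huQ, hulow⟩ := mem_filter.1 hu
  have hxq : x ≠ q := fun e => hxQ (e ▸ hq)
  obtain ⟨P, hP, hPm, hPc, huP, hxP, hqP, hdom⟩ :=
    h.exists_complete_of_low hr hm0 ih' (hQ huQ) hulow hxS hqS (hxout u hu).1
      (hQc u huQ q hq huq) hxq hqx
  have hPQ : Disjoint P Q := by
    refine h.disjoint_of_isComplete hr hpot3 hP hQ hPm hQm hPc hQc ?_
    have hsub : P ∩ Q ⊆ (Q.erase u).erase q := fun z hz => by
      obtain ⟨hzP, hzQ⟩ := mem_inter.1 hz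
      exact mem_erase.2 ⟨fun e => hqP (e ▸ hzP), mem_erase.2 ⟨fun e => huP (e ▸ hzP), hzQ⟩⟩
    have h1 := card_le_card hsub
    have h2 := card_erase_add_one (mem_erase.2 ⟨huq.symm, hq⟩)
    have h3 := card_erase_add_one huQ
    omega
  obtain ⟨y, -, hyout, hyin⟩ := h.exists_apex hr hm0 hpot3 hP hPc hPm
  -- A low vertex of `P` has the apex as its only out-neighbour outside `P`, and `hdom` gives it one
  -- in `{x, q}`.
  have hy : y = x ∨ y = q := by
    have h0 := card_le_card_low hr h hP
    obtain ⟨p, hp⟩ : (low r m S P).Nonempty := card_pos.1 (by omega)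
    rcases (hdom p (low_subset _ hp)).1 with hpx | hpq
    · exact .inl ((hyout p hp).2 x (mem_sdiff.2 ⟨hxS, hxP⟩) hpx).symm
    · exact .inr ((hyout p hp).2 q (mem_sdiff.2 ⟨hqS, hqP⟩) hpq).symm
  rcases hy with rfl | rfl
  -- Apex `x`: its out-degree is at least the number of vertices of `P ∪ Q` of in-degree `m`, and
  -- dually. Adding both excess bounds gives `-pot ≥ m`.
  · have hA : P ∪ Q ⊆ S := union_subset hP hQ
    have hyA : y ∉ P ∪ Q := notMem_union.2 ⟨hxP, hxQ⟩
    have h1 := outDeg_add_card_le hr h hA hxS hyA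
    have h2 := outDeg_add_card_le (r := fun a b => r b a) hr h.swap hA hxS hyA
    have hlow : ∀ (r : V → V → Prop), ∀ p ∈ low r m S (P ∪ Q),
        p ∈ low r m S P ∨ p ∈ low r m S Q := by
      intro r p hp
      rwa [low, filter_union, mem_union] at hp
    have h3 := card_low_le_outDeg (r := r) (m := m) hA (y := y) fun p hp =>
      (hlow _ p hp).elim (fun hp => (hyin p hp).1) fun hp => (hxin p hp).1
    have h4 := card_low_le_outDeg (r := fun a b => r b a) (m := m) hA (y := y) fun p hp =>
      (hlow _ p hp).elim (fun hp => (hyout p hp).1) fun hp => (hxout p hp).1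
    have h5 := card_union_of_disjoint hPQ
    change #(low r m S (P ∪ Q)) ≤ _ at h4
    rw [pot_swap] at h2
    omega
  -- Apex `q`: besides the low vertices of `P`, it has `m - 1` neighbours in each direction inside
  -- `Q`. Adding both bounds gives `-pot ≥ m - 1`.
  · have h1 := outDeg_add_card_le hr h hP hqS hqP
    have h2 := outDeg_add_card_le (r := fun a b => r b a) hr h.swap hP hqS hqP
    have key : ∀ (s : V → V → Prop), IsComplete s Q → (∀ v, ¬ s v v) →
        (∀ p ∈ low (fun a b => s b a) m S P, s y p) →
        #(low (fun a b => s b a) m S P) + m ≤ outDeg s S y + 1 := by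
      intro s hs hs' hy
      have h3 := outDeg_mono (r := s) (union_subset hP hQ) y
      rw [outDeg_union hPQ] at h3
      have h4 := hs.outDeg_add_one hs' hq
      have h5 := (card_low_le_outDeg (r := s) (m := m) hP hy)
      have h6 : #(low (fun a b => s b a) m S P) ≤ outDeg s P y :=
        card_le_card fun p hp => mem_filter.2 ⟨low_subset _ hp, hy p hp⟩
      omega
    have h3 := key r hQc hr fun p hp => (hyin p hp).1
    have h4 := key (fun a b => r b a) hQc.swap hr fun p hp => (hyout p hp).1
    change #(low r m S P) + m ≤ _ at h4
    rw [pot_swap] at h2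
    omega

/-! ### Translation to digraphs -/

theorem isDicolouring_of_isCol [Fintype V] {G : Digraph V} {α : Type*} {φ : V → α}
    (h : IsCol G.Adj univ φ) : G.IsDicolouring φ := by
  rintro c ⟨v, hv⟩ hcyc
  refine h v (TransGen.lift Subtype.val ?_ _ _ hcyc)
  rintro ⟨a, ha⟩ ⟨b, hb⟩ hab
  exact ⟨mem_univ _, mem_univ _, hab, Eq.trans ha (Eq.symm hb)⟩

theorem transGen_subtype {p : V → Prop} {R : V → V → Prop} {R' : Subtype p → Subtype p → Prop}
    (h : ∀ a b, R a b → ∃ ha hb, R' ⟨a, ha⟩ ⟨b, hb⟩) {a b : V} (hab : TransGen R a b) :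
    ∃ ha hb, TransGen R' ⟨a, ha⟩ ⟨b, hb⟩ := by
  induction hab with
  | single hab =>
    obtain ⟨ha, hb, hab⟩ := h _ _ hab
    exact ⟨ha, hb, .single hab⟩
  | tail _ hbc ih =>
    obtain ⟨ha, hb, hab⟩ := ih
    obtain ⟨_, hc, hbc⟩ := h _ _ hbc
    exact ⟨ha, hc, hab.tail hbc⟩

theorem col_of_dicolourable {G : Digraph V} {H : G.Subdigraph} {n : ℕ} (hnm : n ≤ m)
    (hm : 0 < m) (hS : ∀ v ∈ S, v ∈ H.verts) (hadj : ∀ a ∈ S, ∀ b ∈ S, G.Adj a b → H.Adj a b)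
    (h : H.toDigraph.Dicolourable n) : Col G.Adj m S := by
  obtain ⟨φ, hφ⟩ := h
  -- Colour `0` outside `H.verts` is harmless, as `S` lies inside `H.verts`.
  refine ⟨fun v => if hv : v ∈ H.verts then Fin.castLE hnm (φ ⟨v, hv⟩) else ⟨0, hm⟩, ?_⟩
  intro v hv
  obtain ⟨hvH, _, hcyc⟩ : ∃ ha hb,
      TransGen (fun x y : H.verts => H.toDigraph.Adj x y ∧ φ x = φ y) ⟨v, ha⟩ ⟨v, hb⟩ := by
    refine transGen_subtype (p := fun v => v ∈ H.verts) (fun a b hab => ?_) hv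
    obtain ⟨ha, hb, hab, e⟩ := hab
    dsimp only at e
    rw [dif_pos (hS a ha), dif_pos (hS b hb)] at e
    exact ⟨hS a ha, hS b hb, hadj a ha b hb hab, Fin.castLE_injective hnm e⟩
  -- The colour is constant along the walk, so the closed walk stays in the class of `v`.
  have key : ∀ y : H.verts,
      TransGen (fun x y : H.verts => H.toDigraph.Adj x y ∧ φ x = φ y) ⟨v, hvH⟩ y →
      ∃ hy, TransGen (H.toDigraph.inducedOn (φ ⁻¹' {φ ⟨v, hvH⟩})).Adj
        ⟨⟨v, hvH⟩, rfl⟩ ⟨y, hy⟩ := by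
    intro y hy
    induction hy with
    | single h => exact ⟨h.2.symm, .single h.1⟩
    | tail _ h ih =>
      obtain ⟨hb, ih⟩ := ih
      exact ⟨h.2.symm.trans hb, ih.tail h.1⟩
  obtain ⟨_, hcyc'⟩ := key _ hcyc
  exact hφ _ _ hcyc'

/-- Of all proper subdigraphs, those obtained by deleting one vertex suffice. -/
theorem crit_of_isKDicritical [Fintype V] {G : Digraph V} (hm : 0 < m)
    (hG : G.IsKDicritical (m + 1)) : Crit G.Adj m univ := by
  constructor
  · rintro ⟨φ, hφ⟩
    have h1 : G.dichromaticNumber ≤ m := iInf₂_le m ⟨φ, isDicolouring_of_isCol hφ⟩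
    rw [hG.2] at h1
    have := Nat.cast_le.1 h1
    omega
  · intro v _
    let H : G.Subdigraph :=
      { verts := {w | w ≠ v}
        Adj := fun a b => a ≠ v ∧ b ≠ v ∧ G.Adj a b
        adj_sub := fun h => h.2.2
        fst_mem := fun h => h.1
        snd_mem := fun h => h.2.1 }
    have hH : H.IsProper := .inl fun e => (e ▸ Set.mem_univ v : v ∈ H.verts) rfl
    have hlt := hG.1 H hH
    rw [hG.2, Digraph.dichromaticNumber, iInf_lt_iff] at hlt
    obtain ⟨n, hlt⟩ := hlt
    obtain ⟨hn, hlt⟩ := iInf_lt_iff.1 hlt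
    have hlt' := Nat.cast_lt.1 hlt
    refine col_of_dicolourable (H := H) (n := n) (by omega) hm (fun w hw => ?_)
      (fun a ha b hb hab => ?_) hn
    · exact (mem_erase.1 hw).1
    · exact ⟨(mem_erase.1 ha).1, (mem_erase.1 hb).1, hab⟩

theorem ncard_arcSet [Fintype V] (G : Digraph V) : G.arcSet.ncard = arcs G.Adj univ univ := by
  have : G.arcSet = (({p | G.Adj p.1 p.2} : Finset (V × V)) : Set (V × V)) := by
    ext p
    simp [Digraph.arcSet]
  rw [this, Set.ncard_coe_finset]
  simp only [arcs, outDeg, card_filter, ← univ_product_univ, sum_product]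

theorem totalDegree_eq [Fintype V] {G : Digraph V} (hr : ∀ v, ¬ G.Adj v v) (v : V) :
    G.totalDegree v = outDeg G.Adj univ v + outDeg (fun a b => G.Adj b a) univ v := by
  have h1 : G.outNeighbours v = (({b | G.Adj v b} : Finset V) : Set V) := by
    ext b
    simpa [Digraph.outNeighbours] using fun h e => hr v (by rwa [e] at h)
  have h2 : G.inNeighbours v = (({b | G.Adj b v} : Finset V) : Set V) := by
    ext b
    simpa [Digraph.inNeighbours] using fun h e => hr v (by rwa [e] at h)
  rw [Digraph.totalDegree, h1, h2, Set.ncard_coe_finset, Set.ncard_coe_finset]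
  rfl

/-- Out-degrees and in-degrees each contribute `-pot`, since reversing all arcs preserves the
potential. -/
theorem excess_eq [Fintype V] {G : Digraph V} (hr : ∀ v, ¬ G.Adj v v) :
    G.excess (m + 1) = - 2 * pot G.Adj m univ := by
  have h1 := sum_excess (r := G.Adj) (m := m) (S := univ)
  have h2 := sum_excess (r := fun a b => G.Adj b a) (m := m) (S := univ)
  rw [pot_swap] at h2
  calc G.excess (m + 1) = ∑ v, (((outDeg G.Adj univ v : ℤ) - m) +
        ((outDeg (fun a b => G.Adj b a) univ v : ℤ) - m)) := by
        refine sum_congr rfl fun v _ => ?_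
        rw [Digraph.vertexExcess, totalDegree_eq hr]
        push_cast
        ring
    _ = _ := by
        rw [sum_add_distrib, h1, h2]
        ring

theorem isomorphic_symmComplete [Fintype V] {G : Digraph V} {k : ℕ} (hr : ∀ v, ¬ G.Adj v v)
    (hk : Fintype.card V = k) (hG : IsComplete G.Adj univ) :
    G.Isomorphic (Digraph.symmComplete k) := by
  refine ⟨⟨Fintype.equivFinOfCardEq hk, fun {a b} => ?_⟩⟩
  change _ ≠ _ ↔ _
  rw [Ne, EmbeddingLike.apply_eq_iff_eq]
  exact ⟨fun h => hG a (mem_univ _) b (mem_univ _) h, fun h e => hr a (by rwa [← e] at h)⟩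

end Dicritical

end

theorem mainTheorem1 {V : Type*} [Fintype V] (G : Digraph V)
    (hloopless : ∀ v : V, ¬ G.Adj v v) (k : ℕ) (hk : 4 ≤ k)
    (hG : G.IsKDicritical k) (hne : ¬ G.Isomorphic (Digraph.symmComplete k)) :
    ((k : ℤ) - 1) * (Fintype.card V : ℤ) + (k : ℤ) - 3 ≤ (G.arcSet.ncard : ℤ) ∧
      2 * ((k : ℤ) - 3) ≤ G.excess k := by
  obtain ⟨m, rfl⟩ : ∃ m, k = m + 1 := ⟨k - 1, by omega⟩
  have hc := Dicritical.crit_of_isKDicritical (by omega) hG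
  have hpot : Dicritical.pot G.Adj m Finset.univ ≤ 2 - m := by
    rcases hc.isComplete_or_pot_le (by omega) hloopless with ⟨hcard, hcomp⟩ | h
    · exact (hne (Dicritical.isomorphic_symmComplete hloopless hcard hcomp)).elim
    · exact h
  constructor
  · rw [Dicritical.ncard_arcSet]
    rw [Dicritical.pot, Finset.card_univ] at hpot
    push_cast
    linarith
  · rw [Dicritical.excess_eq hloopless]
    push_cast
    linarith
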